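/- Notation. For $f,g:\mathbb N\to\mathbb N$ (with $0\in\mathbb N$) write $f\preceq g$ if there is a natural number $t$ with $f(n)\le t\,g(tn)$ for all $n$; write $f\sim g$ if $f\preceq g$ and $g\preceq f$, let $[f]$ be the class of $f$ under $\sim$, and put $[f]\le[g]$ if $f\preceq g$. The superadditive closure of $f$ is $$\overline f(n)=\max\{f(n_1)+\cdots+f(n_t)\;:\;n_1+\cdots+n_t=n,\ n_i\ge 1\}$$ (with $\overline f(0)=0$, the empty sum); put $\overline{[f]}=[\overline f]$. This does not depend on the choice of $f$ in its class. A class $c$ is called superadditive if $c=\overline c$. All algebras are over a fixed field $F$. If a unital associative algebra $A$ is generated by a finite set $X$, its degree filtration defined by $X$ is $A_0=\langle 1\rangle$, $A_n=A_{n-1}+\langle X^n\rangle$ for $n\ge 1$. If a Lie algebra $L$ is generated by a finite set $X$, its degree filtration defined by $X$ is given by letting $L_n$ be the linear span of all Lie monomials of length at most $n$ in elements of $X$ (so $L_0=0$ and $L_1=\langle X\rangle$). If $\varphi:B\to A$ is an embedding of finitely generated algebras (both unital associative, or both Lie), with degree filtrations $\{A_n\}$ and $\{B_n\}$ defined by some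 finite generating sets, the distortion of $B$ in $A$ is the class $\mathrm{dist}_A^B=[f]$ of the function $$f(n)=\min\{m : A_n\cap\varphi(B)\subseteq\varphi(B_m)\}.$$ Theorem 2.10. Let $L$ be a finitely generated Lie algebra over a field and let $M$ be a finitely generated subalgebra of $L$. Then the canonical homomorphism $U(M)\to U(L)$ of universal enveloping algebras is injective, and, with $U(M)$ regarded as a subalgebra of $U(L)$ in this way and for every choice of the finite generating sets of $L$, $M$, $U(L)$ and $U(M)$ that are used to compute the distortions, $$\mathrm{dist}_{U(L)}^{U(M)}=\overline{\,\mathrm{dist}_L^M\,}.$$ In particular $\mathrm{dist}_L^M\le \mathrm{dist}_{U(L)}^{U(M)}$, and $\mathrm{dist}_{U(L)}^{U(M)}$ is superadditive. -/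

import Mathlib

/-! Growth functions -/

/-- `f` is majorated by `g`. -/
def Majorated (f g : ℕ → ℕ) : Prop :=
  ∃ t : ℕ, ∀ n : ℕ, f n ≤ t * g (t * n)

theorem Majorated.refl (f : ℕ → ℕ) : Majorated f f := ⟨1, fun n => by simp⟩

theorem Majorated.trans {f g h : ℕ → ℕ} (h₁ : Majorated f g) (h₂ : Majorated g h) :
    Majorated f h := by
  obtain ⟨t, ht⟩ := h₁
  obtain ⟨s, hs⟩ := h₂
  refine ⟨t * s, fun n => (ht n).trans ?_⟩
  calc t * g (t * n) ≤ t * (s * h (s * (t * n))) := Nat.mul_le_mul_left _ (hs _)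
    _ = t * s * h (t * s * n) := by
      rw [mul_assoc t s (h _), ← mul_assoc s t n, mul_comm s t]

/-- Two functions are equivalent if each is majorated by the other. -/
def growthSetoid : Setoid (ℕ → ℕ) where
  r f g := Majorated f g ∧ Majorated g f
  iseqv :=
    { refl := fun f => ⟨Majorated.refl f, Majorated.refl f⟩
      symm := fun h => ⟨h.2, h.1⟩
      trans := fun h₁ h₂ => ⟨h₁.1.trans h₂.1, h₂.2.trans h₁.2⟩ }

/-- Equivalence classes of functions `ℕ → ℕ`. -/
def GrowthClass : Type := Quotient growthSetoid

/-- The class `[f]`. -/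
def GrowthClass.mk (f : ℕ → ℕ) : GrowthClass := Quotient.mk growthSetoid f

/-- `[f] ≤ [g]` if and only if `f` is majorated by `g`. -/
instance : LE GrowthClass where
  le := Quotient.lift₂ Majorated fun _ _ _ _ h₁ h₂ =>
    propext ⟨fun h => h₁.2.trans (h.trans h₂.1), fun h => h₁.1.trans (h.trans h₂.2)⟩

/-- The superadditive closure: the value at `n` is the maximum of `f n₁ + ⋯ + f nₜ` over all
`n₁ + ⋯ + nₜ = n` with all `nᵢ` positive. For `f 0 = 0` this is the least superadditive function
that is `≥ f`. -/
def superadditiveClosure (f : ℕ → ℕ) (n : ℕ) : ℕ :=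
  Finset.univ.sup fun c : Composition n => (c.blocks.map f).sum

theorem Majorated.superadditiveClosure {f g : ℕ → ℕ} (h : Majorated f g) :
    Majorated (superadditiveClosure f) (superadditiveClosure g) := by
  obtain ⟨t, ht⟩ := h
  refine ⟨t, fun n => Finset.sup_le fun c _ => ?_⟩
  have hsum : (c.blocks.map f).sum ≤ t * ((c.blocks.map fun k => t * k).map g).sum := by
    rw [List.map_map, ← List.sum_map_mul_left]
    exact List.sum_le_sum fun k _ => ht k
  rcases Nat.eq_zero_or_pos t with rfl | htp
  · simpa using hsum
  · refine hsum.trans (Nat.mul_le_mul_left _ ?_)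
    let c' : Composition (t * n) :=
      { blocks := c.blocks.map fun k => t * k
        blocks_pos := by
          intro i hi
          obtain ⟨k, hk, rfl⟩ := List.mem_map.1 hi
          exact Nat.mul_pos htp (c.blocks_pos hk)
        blocks_sum := by
          rw [List.sum_map_mul_left, List.map_id', c.blocks_sum] }
    exact Finset.le_sup (f := fun c : Composition (t * n) => (c.blocks.map g).sum)
      (Finset.mem_univ c')

/-- The superadditive closure of a class: the closure of `[f]` is the class of the closure
of `f`. -/
def GrowthClass.closure : GrowthClass → GrowthClass :=
  Quotient.lift (fun f => GrowthClass.mk (superadditiveClosure f)) fun _ _ h =>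
    Quotient.sound ⟨h.1.superadditiveClosure, h.2.superadditiveClosure⟩

/-- A class is superadditive if it equals its superadditive closure. -/
def GrowthClass.IsSuperadditive (c : GrowthClass) : Prop := c = c.closure

/-! Degree filtrations -/

/-- `IsLieMonomial X k a`: the element `a` is the value of a Lie monomial of length `k`, with some
arrangement of brackets, in elements of `X`. -/
inductive IsLieMonomial {L : Type*} [LieRing L] (X : Set L) : ℕ → L → Prop
  | of (x : L) (hx : x ∈ X) : IsLieMonomial X 1 x
  | lie (i j : ℕ) (a b : L) (ha : IsLieMonomial X i a) (hb : IsLieMonomial X j b) :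
      IsLieMonomial X (i + j) ⁅a, b⁆

/-- The degree filtration of a Lie algebra defined by `X`: the `n`-th term is spanned by the Lie
monomials of length at most `n` in `X`. In particular the term with `n = 0` is zero and the term
with `n = 1` is the span of `X`. -/
def lieDegreeFiltration (F : Type*) {L : Type*} [Field F] [LieRing L] [LieAlgebra F L]
    (X : Set L) (n : ℕ) : Submodule F L :=
  Submodule.span F {a | ∃ k ≤ n, IsLieMonomial X k a}

/-- The degree filtration of a unital associative algebra defined by `X`: `A₀ = ⟨1⟩` and
`Aₙ = Aₙ₋₁ + ⟨Xⁿ⟩`. -/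
def assocDegreeFiltration (F : Type*) {A : Type*} [Field F] [Ring A] [Algebra F A]
    (X : Set A) : ℕ → Submodule F A
  | 0 => Submodule.span F {1}
  | n + 1 => assocDegreeFiltration F X n ⊔ Submodule.span F X ^ (n + 1)

/-- The distortion function of a map `φ : B → A` with respect to a filtration `α` of `A` and a
filtration `β` of `B`: the least `m` with `Aₙ ∩ φ(B) ⊆ φ(Bₘ)`. -/
noncomputable def distortion {F A B : Type*} [Field F] [AddCommGroup A] [Module F A]
    [AddCommGroup B] [Module F B] (φ : B →ₗ[F] A) (α : ℕ → Submodule F A)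
    (β : ℕ → Submodule F B) (n : ℕ) : ℕ :=
  sInf {m : ℕ | α n ⊓ LinearMap.range φ ≤ (β m).map φ}

/-- The canonical homomorphism `U(M) → U(L)` induced by the inclusion of a subalgebra `M` of `L`.
The bracket on an associative algebra is the commutator. -/
noncomputable def envelopingMap {F L : Type*} [Field F] [LieRing L] [LieAlgebra F L]
    (M : LieSubalgebra F L) :
    UniversalEnvelopingAlgebra F M →ₐ[F] UniversalEnvelopingAlgebra F L :=
  letI : LieRing (UniversalEnvelopingAlgebra F L) := LieRing.ofAssociativeRing
  UniversalEnvelopingAlgebra.lift F ((UniversalEnvelopingAlgebra.ι F).comp M.incl)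

/-- The distortion of a subalgebra `M` in a Lie algebra `L`, computed with generating sets `X` of
`L` and `Y` of `M`. -/
noncomputable def lieDistortion {F L : Type*} [Field F] [LieRing L] [LieAlgebra F L]
    (M : LieSubalgebra F L) (X : Set L) (Y : Set M) : GrowthClass :=
  GrowthClass.mk (distortion (M.incl : M →ₗ[F] L)
    (lieDegreeFiltration F X) (lieDegreeFiltration F Y))

/-- The distortion of a homomorphism `φ : B → A` of unital associative algebras, computed with
generating sets `X` of `A` and `Y` of `B`. -/
noncomputable def assocDistortion {F A B : Type*} [Field F] [Ring A] [Algebra F A] [Ring B]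
    [Algebra F B] (φ : B →ₐ[F] A) (X : Set A) (Y : Set B) : GrowthClass :=
  GrowthClass.mk (distortion φ.toLinearMap
    (assocDegreeFiltration F X) (assocDegreeFiltration F Y))

-- Write f for the distortion function of M in L. For the generating sets ι(X) of U(L) and ι(Y) of
-- U(M), the distortion function of U(M) in U(L) is equal to the superadditive closure of f, not
-- merely equivalent to it (`envelopingDistortionFun_eq`). Other finite generating sets rescale the
-- filtrations linearly, which preserves the class.
--
-- The tool is a filtered Poincaré–Birkhoff–Witt theorem. If a basis of L is adapted to the degree
-- filtration and each basis vector is weighted by its order, the ordered monomials of weight at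
-- most n form a basis of the n-th term of U(L) (`assocDegreeFiltration_eq_weightSpan`).
--
-- Upper bound: take an adapted basis of L that contains a basis of M. An element of U(M) in the
-- n-th term of U(L) is a combination of ordered monomials in the basis of M of weight at most n. A
-- factor of weight k lies in the f(k)-th term of M, so such a monomial has degree in U(M) at most a
-- sum of values f(k) with the k adding up to at most n.
--
-- Lower bound: for each positive value of f choose one vector of M that attains it. These vectors
-- have distinct orders with respect to Y, so a single adapted basis of M contains all of them. For
-- n = n₁ + ⋯ + nₜ, the ordered product of the vectors belonging to the f(nᵢ) lies in the n-th term
-- of U(L), and its order in U(M) is exactly the sum of the f(nᵢ).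

attribute [local instance] LieRing.ofAssociativeRing

namespace UniversalEnvelopingAlgebra

open Module

/-! ### Poincaré–Birkhoff–Witt: linear independence of ordered monomials -/

section PBW

variable {F L I : Type*} [Field F] [LieRing L] [LieAlgebra F L]
  (b : Basis I F L)

/-- The bilinear map `L × F[I] → F[I]` with prescribed values on pairs of a basis vector and a
monomial, where monomials are encoded as multisets. -/
noncomputable def bilinExtend (a : I → Multiset I → (Multiset I →₀ F)) :
    L →ₗ[F] (Multiset I →₀ F) →ₗ[F] (Multiset I →₀ F) :=
  b.constr F fun i => Finsupp.linearCombination F (a i)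

@[simp]
theorem bilinExtend_basis_single (a : I → Multiset I → (Multiset I →₀ F)) (i : I)
    (s : Multiset I) : bilinExtend b a (b i) (Finsupp.single s 1) = a i s := by
  simp [bilinExtend, Basis.constr_basis]

variable (F I) in
/-- Polynomials of degree at most `n`. -/
def degreeLE (n : ℕ) : Submodule F (Multiset I →₀ F) :=
  Finsupp.supported F F {s | s.card ≤ n}

theorem single_mem_degreeLE {s : Multiset I} {n : ℕ} (h : s.card ≤ n) (c : F) :
    Finsupp.single s c ∈ degreeLE F I n :=
  Finsupp.single_mem_supported F c h

theorem degreeLE_mono {m n : ℕ} (h : m ≤ n) : degreeLE F I m ≤ degreeLE F I n :=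
  Finsupp.supported_mono fun _ hs => le_trans (Set.mem_ofPred.1 hs) h

theorem degreeLE_induction {n : ℕ} {P : Submodule F (Multiset I →₀ F)}
    (h : ∀ s : Multiset I, s.card ≤ n → Finsupp.single s 1 ∈ P) : degreeLE F I n ≤ P := by
  rw [degreeLE, Finsupp.supported_eq_span_single, Submodule.span_le]
  rintro _ ⟨s, hs, rfl⟩
  exact h s hs

theorem bilinExtend_mem_degreeLE (a : I → Multiset I → (Multiset I →₀ F))
    (ha : ∀ i s, a i s - Finsupp.single (i ::ₘ s) 1 ∈ degreeLE F I s.card)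
    (x : L) {n : ℕ} {v : Multiset I →₀ F} (hv : v ∈ degreeLE F I n) :
    bilinExtend b a x v ∈ degreeLE F I (n + 1) := by
  suffices h : ∀ i, degreeLE F I n ≤ (degreeLE F I (n + 1)).comap (bilinExtend b a (b i)) by
    have hx : x ∈ (⊤ : Submodule F L) := trivial
    rw [← b.span_eq] at hx
    induction hx using Submodule.span_induction with
    | mem x hx => obtain ⟨i, rfl⟩ := hx; exact h i hv
    | zero => simp
    | add x y _ _ hx hy => simpa using add_mem hx hy
    | smul c x _ hx => simpa using Submodule.smul_mem _ c hx
  intro i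
  refine degreeLE_induction fun s hs => ?_
  rw [Submodule.mem_comap, bilinExtend_basis_single]
  have h1 := degreeLE_mono (hs.trans n.le_succ) (ha i s)
  have h2 := single_mem_degreeLE (F := F) (s := i ::ₘ s) (n := n + 1) (by simpa using hs) 1
  simpa using add_mem h1 h2

variable [LinearOrder I]

open scoped Classical in
/-- The action of a basis vector on a monomial, correct for monomials of degree at most the first
argument. -/
noncomputable def pbwStage : ℕ → I → Multiset I → (Multiset I →₀ F)
  | 0, i, s => Finsupp.single (i ::ₘ s) 1
  | n + 1, i, s =>
    if s.card ≤ n then pbwStage n i s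
    else if h : ∃ j ∈ s, (∀ k ∈ s, j ≤ k) ∧ j < i then
      -- With s = j t and j minimal, this expands x_i x_j t = x_j x_i t + [x_i, x_j] t. The leading
      -- part of x_j x_i t is the monomial i s, and only the remainder of x_i t is acted on by
      -- recursion.
      Finsupp.single (i ::ₘ s) 1
        + bilinExtend b (pbwStage n) (b h.choose)
          (pbwStage n i (s.erase h.choose) - Finsupp.single (i ::ₘ s.erase h.choose) 1)
        + bilinExtend b (pbwStage n) ⁅b i, b h.choose⁆ (Finsupp.single (s.erase h.choose) 1)
    else Finsupp.single (i ::ₘ s) 1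

/-- This makes the recursion meaningful: the correction terms at stage n + 1, on a monomial of
degree n + 1, only use stage n on degree at most n. -/
theorem pbwStage_sub_mem (n : ℕ) (i : I) (s : Multiset I) :
    pbwStage b n i s - Finsupp.single (i ::ₘ s) 1 ∈ degreeLE F I s.card := by
  induction n generalizing i s with
  | zero => simp [pbwStage]
  | succ n ih =>
    rw [pbwStage]
    split_ifs with h1 h2
    · exact ih i s
    · have hc : s.card = (s.erase h2.choose).card + 1 := by
        rw [Multiset.card_erase_add_one h2.choose_spec.1]
      rw [add_assoc, add_sub_cancel_left, hc]
      exact add_mem (bilinExtend_mem_degreeLE b _ ih _ (ih _ _))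
        (bilinExtend_mem_degreeLE b _ ih _ (single_mem_degreeLE le_rfl 1))
    · simp

theorem pbwStage_eq {n : ℕ} {s : Multiset I} (h : s.card ≤ n) (i : I) :
    pbwStage b n i s = pbwStage b s.card i s := by
  induction n, h using Nat.le_induction with
  | base => rfl
  | succ n hn ih => rw [pbwStage, if_pos hn, ih]

/-- The action of `L` on polynomials from the proof of the Poincaré–Birkhoff–Witt theorem. -/
noncomputable def pbwAction : L →ₗ[F] (Multiset I →₀ F) →ₗ[F] (Multiset I →₀ F) :=
  bilinExtend b fun i s => pbwStage b s.card i s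

theorem pbwAction_basis_single (i : I) (s : Multiset I) :
    pbwAction b (b i) (Finsupp.single s 1) = pbwStage b s.card i s := by
  simp [pbwAction]

theorem bilinExtend_pbwStage {n : ℕ} (x : L) {v : Multiset I →₀ F} (hv : v ∈ degreeLE F I n) :
    bilinExtend b (pbwStage b n) x v = pbwAction b x v := by
  suffices h : degreeLE F I n ≤
      LinearMap.eqLocus (bilinExtend b (pbwStage b n)).flip (pbwAction b).flip by
    exact LinearMap.congr_fun (h hv) x
  refine degreeLE_induction fun s hs => b.ext fun i => ?_
  simp [pbwAction_basis_single, pbwStage_eq b hs]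

theorem pbwAction_sub_mem (i : I) (s : Multiset I) :
    pbwAction b (b i) (Finsupp.single s 1) - Finsupp.single (i ::ₘ s) 1
      ∈ degreeLE F I s.card := by
  rw [pbwAction_basis_single]
  exact pbwStage_sub_mem b _ i s

theorem pbwAction_of_le {i : I} {s : Multiset I} (h : ∀ k ∈ s, i ≤ k) :
    pbwAction b (b i) (Finsupp.single s 1) = Finsupp.single (i ::ₘ s) 1 := by
  rw [pbwAction_basis_single]
  rcases hn : s.card with _ | n
  · rfl
  · rw [pbwStage, if_neg (by omega), dif_neg]
    rintro ⟨j, hj, -, hji⟩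
    exact (h j hj).not_gt hji

/-- The recursive clause of `pbwStage` is designed for this relation; the index it selects from `j
::ₘ s` is a least one, hence j. -/
theorem pbwAction_of_lt {i j : I} {s : Multiset I} (hj : ∀ k ∈ s, j ≤ k) (hji : j < i) :
    pbwAction b (b i) (pbwAction b (b j) (Finsupp.single s 1))
      = pbwAction b (b j) (pbwAction b (b i) (Finsupp.single s 1))
        + pbwAction b ⁅b i, b j⁆ (Finsupp.single s 1) := by
  have hex : ∃ j' ∈ j ::ₘ s, (∀ k ∈ j ::ₘ s, j' ≤ k) ∧ j' < i :=
    ⟨j, by simp, by simpa using hj, hji⟩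
  have hch : hex.choose = j := by
    obtain ⟨h1, h2, -⟩ := hex.choose_spec
    refine le_antisymm (h2 j (by simp)) ?_
    rcases Multiset.mem_cons.1 h1 with h | h
    · exact h.ge
    · exact hj _ h
  have h1 : pbwAction b (b j) (Finsupp.single (i ::ₘ s) 1)
      = Finsupp.single (i ::ₘ j ::ₘ s) 1 := by
    rw [pbwAction_of_le b (by simpa using ⟨hji.le, hj⟩), Multiset.cons_swap]
  rw [pbwAction_of_le b hj, pbwAction_basis_single, Multiset.card_cons, pbwStage,
    if_neg (by simp), dif_pos hex]
  simp only [hch, Multiset.erase_cons_head]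
  rw [bilinExtend_pbwStage b _ (pbwStage_sub_mem b _ i s),
    bilinExtend_pbwStage b _ (single_mem_degreeLE le_rfl 1), map_sub, h1,
    ← pbwAction_basis_single]
  abel

/-- The failure of `pbwAction` to respect the bracket. -/
noncomputable def pbwDefect : L →ₗ[F] L →ₗ[F] (Multiset I →₀ F) →ₗ[F] (Multiset I →₀ F) :=
  LinearMap.mk₂ F
    (fun x y => pbwAction b x ∘ₗ pbwAction b y - pbwAction b y ∘ₗ pbwAction b x
      - pbwAction b ⁅x, y⁆)
    (fun x y z => by simp only [map_add, add_lie, LinearMap.add_comp, LinearMap.comp_add]; abel)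
    (fun c x y => by
      simp only [map_smul, smul_lie, LinearMap.smul_comp, LinearMap.comp_smul]; module)
    (fun x y z => by simp only [map_add, lie_add, LinearMap.add_comp, LinearMap.comp_add]; abel)
    (fun c x y => by
      simp only [map_smul, lie_smul, LinearMap.smul_comp, LinearMap.comp_smul]; module)

theorem pbwDefect_apply (x y : L) (v : Multiset I →₀ F) :
    pbwDefect b x y v = pbwAction b x (pbwAction b y v) - pbwAction b y (pbwAction b x v)
      - pbwAction b ⁅x, y⁆ v := rfl

theorem pbwDefect_swap (x y : L) (v : Multiset I →₀ F) :
    pbwDefect b x y v = - pbwDefect b y x v := by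
  rw [pbwDefect_apply, pbwDefect_apply, ← lie_skew, map_neg, LinearMap.neg_apply]
  abel

theorem pbwDefect_of_lt {i j : I} {s : Multiset I} (hj : ∀ k ∈ s, j ≤ k) (hji : j < i) :
    pbwDefect b (b i) (b j) (Finsupp.single s 1) = 0 := by
  rw [pbwDefect_apply, pbwAction_of_lt b hj hji]
  abel

theorem pbwDefect_eq_zero_of_basis {n : ℕ}
    (h : ∀ s : Multiset I, s.card ≤ n → ∀ i j, pbwDefect b (b i) (b j) (Finsupp.single s 1) = 0)
    (x y : L) {v : Multiset I →₀ F} (hv : v ∈ degreeLE F I n) : pbwDefect b x y v = 0 := by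
  suffices h' : degreeLE F I n ≤ LinearMap.ker (pbwDefect b x y) from h' hv
  refine degreeLE_induction fun s hs => ?_
  have : (pbwDefect b).compr₂ (LinearMap.applyₗ (Finsupp.single s (1 : F))) = 0 :=
    LinearMap.ext_basis b b fun i j => h s hs i j
  exact LinearMap.congr_fun₂ this x y

/-- If i or j is at most every index of s, the defect vanishes by construction. Otherwise the least
index k of s = k t is below both, the monomial s is x_k t, and the Jacobi identity reduces the claim
to defects already known to vanish. -/
theorem pbwDefect_single (n : ℕ) : ∀ s : Multiset I, s.card ≤ n → ∀ i j,
    pbwDefect b (b i) (b j) (Finsupp.single s 1) = 0 := by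
  induction n with
  | zero =>
    intro s hs i j
    obtain rfl : s = 0 := by simpa using hs
    rcases lt_trichotomy i j with h | rfl | h
    · rw [pbwDefect_swap, pbwDefect_of_lt b (by simp) h, neg_zero]
    · simp [pbwDefect_apply]
    · exact pbwDefect_of_lt b (by simp) h
  | succ n ih =>
    have IH := fun x y v hv => pbwDefect_eq_zero_of_basis b ih x y (v := v) hv
    intro s hs i j
    obtain rfl | hs0 := eq_or_ne s 0
    · exact ih 0 (by simp) i j
    obtain ⟨k, hk, hmin⟩ : ∃ k ∈ s, ∀ l ∈ s, k ≤ l := by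
      have := s.toFinset.exists_min_image id (by simpa [Multiset.toFinset_nonempty] using hs0)
      simpa using this
    obtain ⟨t, rfl⟩ := Multiset.exists_cons_of_mem hk
    have hkt : ∀ l ∈ t, k ≤ l := fun l hl => hmin l (by simp [hl])
    have htn : t.card ≤ n := by simpa using hs
    obtain rfl | hij := eq_or_ne i j
    · simp [pbwDefect_apply]
    by_cases hki : k < i; swap
    · have hik : ∀ l ∈ k ::ₘ t, i ≤ l := fun l hl => (not_lt.1 hki).trans (hmin l hl)
      rcases hij.lt_or_gt with h | h
      · rw [pbwDefect_swap, pbwDefect_of_lt b hik h, neg_zero]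
      · exact pbwDefect_of_lt b (fun l hl => h.le.trans (hik l hl)) h
    by_cases hkj : k < j; swap
    · have hjk : ∀ l ∈ k ::ₘ t, j ≤ l := fun l hl => (not_lt.1 hkj).trans (hmin l hl)
      rcases hij.lt_or_gt with h | h
      · rw [pbwDefect_swap, pbwDefect_of_lt b (fun l hl => h.le.trans (hjk l hl)) h, neg_zero]
      · exact pbwDefect_of_lt b hjk h
    -- The leading monomial q t of x_q t has k below all its indices, so its defect vanishes by
    -- construction; the remainder has degree at most n and falls under the induction hypothesis.
    have key : ∀ p q : I, k < p → k < q →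
        pbwDefect b (b p) (b k) (pbwAction b (b q) (Finsupp.single t 1)) = 0 := by
      intro p q hp hq
      have h1 := IH (b p) (b k) _ (degreeLE_mono htn (pbwAction_sub_mem b q t))
      rwa [map_sub, pbwDefect_of_lt b (i := p) (s := q ::ₘ t) (by simpa using ⟨hq.le, hkt⟩) hp,
        sub_zero] at h1
    have ht := single_mem_degreeLE (F := F) htn 1
    have e1 := key i j hki hkj
    have e2 := key j i hkj hki
    have e3 := IH (b i) ⁅b j, b k⁆ _ ht
    have e4 := IH (b j) ⁅b i, b k⁆ _ ht
    have e5 := congrArg (pbwAction b (b k)) (IH (b i) (b j) _ ht)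
    have e6 := IH (b k) ⁅b i, b j⁆ _ ht
    have e7 := congrArg (pbwAction b (b i)) (pbwAction_of_lt b hkt hkj)
    have e8 := congrArg (pbwAction b (b j)) (pbwAction_of_lt b hkt hki)
    have jac := congrArg (fun x => pbwAction b x (Finsupp.single t 1))
      (lie_jacobi (b i) (b j) (b k))
    have hsk : ⁅b j, ⁅b k, b i⁆⁆ = -⁅b j, ⁅b i, b k⁆⁆ := by rw [← lie_skew (b k), lie_neg]
    simp only [pbwDefect_apply, map_sub, map_add, map_zero, map_neg, hsk, LinearMap.add_apply,
      LinearMap.neg_apply, LinearMap.zero_apply, pbwAction_of_le b hkt] at *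
    rw [e7, e8]
    linear_combination (norm := module) e1 - e2 + e3 - e4 + e5 + e6 + jac

theorem pbwDefect_eq_zero (x y : L) (v : Multiset I →₀ F) : pbwDefect b x y v = 0 := by
  refine pbwDefect_eq_zero_of_basis b (pbwDefect_single b (v.support.sup Multiset.card)) x y ?_
  exact (Finsupp.mem_supported F v).2 fun s hs => Finset.le_sup (f := Multiset.card) hs

/-- The representation of `L` on polynomials. -/
noncomputable def pbwRep : L →ₗ⁅F⁆ Module.End F (Multiset I →₀ F) :=
  { pbwAction b with
    map_lie' := by
      intro x y
      refine LinearMap.ext fun v => ?_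
      have := pbwDefect_eq_zero b x y v
      rw [pbwDefect_apply, sub_eq_zero] at this
      exact this.symm }

theorem pbwRep_apply (x : L) : pbwRep b x = pbwAction b x := rfl

/-- The product of the basis vectors with indices in a list. -/
noncomputable def listMonomial (l : List I) : UniversalEnvelopingAlgebra F L :=
  (l.map fun i => ι F (b i)).prod

/-- The product in increasing order of the basis vectors with indices in a multiset. -/
noncomputable def orderedMonomial (s : Multiset I) : UniversalEnvelopingAlgebra F L :=
  listMonomial b (s.sort (· ≤ ·))

/-- Factors act from the right, so each one meets a monomial whose indices are no smaller and acts
by plain multiplication. -/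
theorem lift_pbwRep_sorted (l : List I) (hl : l.Pairwise (· ≤ ·)) :
    lift F (pbwRep b) (listMonomial b l) (Finsupp.single 0 1)
      = Finsupp.single (l : Multiset I) 1 := by
  induction l with
  | nil => simp [listMonomial]
  | cons i l ih =>
    rw [List.pairwise_cons] at hl
    rw [listMonomial, List.map_cons, List.prod_cons, map_mul, lift_ι_apply,
      Module.End.mul_apply, ← listMonomial, ih hl.2, pbwRep_apply, pbwAction_of_le b (by simpa using hl.1), Multiset.cons_coe]

theorem linearIndependent_orderedMonomial : LinearIndependent F (orderedMonomial b) := by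
  let φ : UniversalEnvelopingAlgebra F L →ₗ[F] (Multiset I →₀ F) :=
    LinearMap.applyₗ (Finsupp.single (0 : Multiset I) (1 : F)) ∘ₗ (lift F (pbwRep b)).toLinearMap
  have : φ ∘ orderedMonomial b = fun s => Finsupp.single s 1 := by
    funext s
    have := lift_pbwRep_sorted b (s.sort (· ≤ ·)) (s.pairwise_sort _)
    rwa [Multiset.sort_eq] at this
  refine LinearIndependent.of_comp φ ?_
  rw [this]
  exact Finsupp.linearIndependent_single_one F _

end PBW

/-! ### Straightening, weights and the PBW basis -/

section Spanning

variable {F L I : Type*} [Field F] [LieRing L] [LieAlgebra F L]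

/-- By the universal property, the lift of ι to the generated subalgebra followed by the inclusion
is the identity. -/
theorem adjoin_range_ι : Algebra.adjoin F (Set.range (ι F : L → _)) = ⊤ := by
  set S := Algebra.adjoin F (Set.range (ι F : L → UniversalEnvelopingAlgebra F L))
  let f : L →ₗ⁅F⁆ S :=
    { toFun := fun x => ⟨ι F x, Algebra.subset_adjoin ⟨x, rfl⟩⟩
      map_add' := fun x y => Subtype.ext (map_add (ι F) x y)
      map_smul' := fun c x => Subtype.ext (map_smul (ι F) c x)
      map_lie' := fun {x y} => Subtype.ext (LieHom.map_lie (ι F) x y) }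
  have h : S.val.comp (lift F f) = AlgHom.id F _ := by
    refine hom_ext F (LieHom.ext fun x => ?_)
    change S.val (lift F f (ι F x)) = ι F x
    rw [lift_ι_apply]
    rfl
  refine eq_top_iff.2 fun x _ => ?_
  have hx : (lift F f x : UniversalEnvelopingAlgebra F L) = x := AlgHom.congr_fun h x
  have hS := (lift F f x).2
  rwa [hx] at hS

variable [LinearOrder I] (b : Basis I F L) (w : I → ℕ)

omit [LinearOrder I] in
theorem listMonomial_append (l l' : List I) :
    listMonomial b (l ++ l') = listMonomial b l * listMonomial b l' := by
  simp [listMonomial]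

omit [LinearOrder I] in
theorem listMonomial_cons (i : I) (l : List I) :
    listMonomial b (i :: l) = ι F (b i) * listMonomial b l := by
  simp [listMonomial]

/-- The span of the ordered monomials of weight at most `n`. -/
noncomputable def weightSpan (n : ℕ) : Submodule F (UniversalEnvelopingAlgebra F L) :=
  Submodule.span F (orderedMonomial b '' {s | (s.map w).sum ≤ n})

theorem weightSpan_mono : Monotone (weightSpan b w) := fun _ _ h =>
  Submodule.span_mono (Set.image_mono fun _ hs => le_trans (Set.mem_ofPred.1 hs) h)

theorem orderedMonomial_mem_weightSpan (s : Multiset I) :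
    orderedMonomial b s ∈ weightSpan b w (s.map w).sum :=
  Submodule.subset_span ⟨s, Set.mem_ofPred.2 le_rfl, rfl⟩

theorem one_mem_weightSpan : 1 ∈ weightSpan b w 0 := by
  simpa [orderedMonomial, listMonomial] using orderedMonomial_mem_weightSpan b w 0

variable {b w}

/-- Sorting swaps adjacent factors. Each swap costs a product with a bracket in place of the two
factors, which is shorter and, by `hw`, of no larger weight; induction on length disposes of it. -/
theorem listMonomial_mem_weightSpan
    (hw : ∀ i j, ⁅b i, b j⁆ ∈ Submodule.span F (b '' {k | w k ≤ w i + w j})) (l : List I) :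
    listMonomial b l ∈ weightSpan b w (l.map w).sum := by
  suffices H : ∀ N, ∀ l : List I, l.length ≤ N →
      listMonomial b l ∈ weightSpan b w (l.map w).sum from H _ l le_rfl
  intro N
  induction N with
  | zero =>
    intro l hl
    obtain rfl : l = [] := by simpa using hl
    exact one_mem_weightSpan b w
  | succ N ih =>
    -- The prefix p lets the induction on permutations pass under a common head.
    have key : ∀ l l' : List I, l.Perm l' → ∀ p : List I, p.length + l.length ≤ N + 1 →
        listMonomial b (p ++ l) - listMonomial b (p ++ l')
          ∈ weightSpan b w ((p ++ l).map w).sum := by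
      intro l l' h
      induction h with
      | nil => simp
      | cons x h ih' =>
        intro p hp
        simpa using ih' (p ++ [x]) (by simp at hp ⊢; omega)
      | swap x y l =>
        intro p hp
        let T : L →ₗ[F] UniversalEnvelopingAlgebra F L :=
          LinearMap.mulLeft F (listMonomial b p) ∘ₗ LinearMap.mulRight F (listMonomial b l)
            ∘ₗ (ι F : L →ₗ⁅F⁆ UniversalEnvelopingAlgebra F L).toLinearMap
        have hT : ∀ z, T z = listMonomial b p * (ι F z * listMonomial b l) := fun z => rfl
        have hdiff : listMonomial b (p ++ y :: x :: l) - listMonomial b (p ++ x :: y :: l)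
            = T ⁅b y, b x⁆ := by
          rw [hT, LieHom.map_lie, LieRing.of_associative_ring_bracket]
          simp only [listMonomial_append, listMonomial_cons, sub_mul, mul_sub, mul_assoc]
        rw [hdiff]
        suffices h' : Submodule.span F (b '' {k | w k ≤ w y + w x}) ≤
            (weightSpan b w ((p ++ y :: x :: l).map w).sum).comap T from h' (hw y x)
        rw [Submodule.span_le]
        rintro _ ⟨k, hk, rfl⟩
        rw [SetLike.mem_coe, Submodule.mem_comap, hT, ← listMonomial_cons, ← listMonomial_append]
        refine weightSpan_mono b w ?_ (ih (p ++ k :: l) (by simp at hp ⊢; omega))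
        have := Set.mem_ofPred.1 hk
        simp
        omega
      | trans h₁ h₂ ih₁ ih₂ =>
        intro p hp
        have h2 := ih₂ p (by rwa [← h₁.length_eq])
        rw [← ((h₁.append_left p).map w).sum_eq] at h2
        simpa using add_mem (ih₁ p hp) h2
    intro l hl
    have hp : l.Perm ((l : Multiset I).sort (· ≤ ·)) := by
      rw [← Multiset.coe_eq_coe, Multiset.sort_eq]
    have h1 := key _ _ hp [] (by simpa using hl)
    have h2 := orderedMonomial_mem_weightSpan b w (l : Multiset I)
    rw [Multiset.map_coe, Multiset.sum_coe] at h2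
    simpa [orderedMonomial] using add_mem h1 h2

theorem mul_mem_weightSpan
    (hw : ∀ i j, ⁅b i, b j⁆ ∈ Submodule.span F (b '' {k | w k ≤ w i + w j})) {m n : ℕ}
    {x y : UniversalEnvelopingAlgebra F L} (hx : x ∈ weightSpan b w m)
    (hy : y ∈ weightSpan b w n) : x * y ∈ weightSpan b w (m + n) := by
  suffices h : weightSpan b w m * weightSpan b w n ≤ weightSpan b w (m + n) from
    h (Submodule.mul_mem_mul hx hy)
  rw [weightSpan, weightSpan, Submodule.span_mul_span, Submodule.span_le]
  rintro _ ⟨_, ⟨s, hs, rfl⟩, _, ⟨t, ht, rfl⟩, rfl⟩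
  have h := listMonomial_mem_weightSpan hw (s.sort (· ≤ ·) ++ t.sort (· ≤ ·))
  rw [listMonomial_append, ← Multiset.sum_coe, ← Multiset.map_coe, ← Multiset.coe_add,
    Multiset.sort_eq, Multiset.sort_eq, Multiset.map_add, Multiset.sum_add] at h
  exact weightSpan_mono b w (add_le_add hs ht) h

theorem ι_mem_weightSpan {n : ℕ} {x : L} (hx : x ∈ Submodule.span F (b '' {i | w i ≤ n})) :
    ι F x ∈ weightSpan b w n := by
  suffices h : Submodule.span F (b '' {i | w i ≤ n}) ≤ (weightSpan b w n).comap
      (ι F : L →ₗ⁅F⁆ UniversalEnvelopingAlgebra F L).toLinearMap from h hx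
  rw [Submodule.span_le]
  rintro _ ⟨i, hi, rfl⟩
  refine weightSpan_mono b w (by simpa using hi) (show ι F (b i) ∈ weightSpan b w (w i) from ?_)
  simpa [orderedMonomial, listMonomial] using orderedMonomial_mem_weightSpan b w {i}

variable (b)

/-- With all weights zero the bracket condition is automatic, and the span of all ordered monomials
is closed under multiplication. -/
theorem span_range_orderedMonomial : Submodule.span F (Set.range (orderedMonomial b)) = ⊤ := by
  obtain ⟨w, hw0⟩ : ∃ w : I → ℕ, ∀ i, w i = 0 := ⟨fun _ => 0, fun _ => rfl⟩
  have htop : ∀ n, Submodule.span F (b '' {k | w k ≤ n}) = ⊤ := fun n => by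
    rw [Set.eq_univ_of_forall (s := {k | w k ≤ n}) fun _ =>
      Set.mem_ofPred.2 (by simp [hw0]), Set.image_univ,
      b.span_eq]
  have hw : ∀ i j, ⁅b i, b j⁆ ∈ Submodule.span F (b '' {k | w k ≤ w i + w j}) := fun i j =>
    (htop (w i + w j)).ge trivial
  have h0 : weightSpan b w 0 = Submodule.span F (Set.range (orderedMonomial b)) := by
    rw [weightSpan, Set.eq_univ_of_forall (s := {s : Multiset I | (s.map w).sum ≤ 0})
      fun s => Set.mem_ofPred.2 (by simp [hw0]), Set.image_univ]
  rw [← h0]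
  refine Submodule.eq_top_iff'.2 fun x => ?_
  have hx : x ∈ Algebra.adjoin F (Set.range (ι F : L → UniversalEnvelopingAlgebra F L)) := by
    rw [adjoin_range_ι]; exact Algebra.mem_top
  induction hx using Algebra.adjoin_induction with
  | mem x hx =>
    obtain ⟨y, rfl⟩ := hx
    exact ι_mem_weightSpan ((htop 0).ge trivial)
  | algebraMap r =>
    rw [Algebra.algebraMap_eq_smul_one]
    exact Submodule.smul_mem _ _ (one_mem_weightSpan b w)
  | add x y _ _ hx hy => exact add_mem hx hy
  | mul x y _ _ hx hy => simpa only [add_zero] using mul_mem_weightSpan hw hx hy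

/-- The Poincaré–Birkhoff–Witt basis of the universal enveloping algebra. -/
noncomputable def pbwBasis : Basis (Multiset I) F (UniversalEnvelopingAlgebra F L) :=
  Basis.mk (linearIndependent_orderedMonomial b) (span_range_orderedMonomial b).ge

@[simp]
theorem coe_pbwBasis : ⇑(pbwBasis b) = orderedMonomial b := Basis.coe_mk _ _

/-- Linear independence makes the weight of a monomial exact; the lower bound for the distortion
rests on this. -/
theorem orderedMonomial_mem_weightSpan_iff {n : ℕ} {s : Multiset I} :
    orderedMonomial b s ∈ weightSpan b w n ↔ (s.map w).sum ≤ n := by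
  rw [weightSpan, ← coe_pbwBasis, Basis.mem_span_image, Basis.repr_self,
    Finsupp.support_single _ (one_ne_zero)]
  simp

/-- Serves both for the identity and for `envelopingMap`, where weights of vectors of M are measured
in L. -/
theorem map_orderedMonomial_mem {A : Type*} [Ring A] [Algebra F A]
    (ψ : UniversalEnvelopingAlgebra F L →ₐ[F] A) {G : ℕ → Submodule F A} (h1 : 1 ∈ G 0)
    (hmul : ∀ {m n x y}, x ∈ G m → y ∈ G n → x * y ∈ G (m + n)) (v : I → ℕ)
    (hv : ∀ i, ψ (ι F (b i)) ∈ G (v i)) (s : Multiset I) :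
    ψ (orderedMonomial b s) ∈ G (s.map v).sum := by
  have h : ∀ l : List I, ψ (listMonomial b l) ∈ G (l.map v).sum := by
    intro l
    induction l with
    | nil => simpa [listMonomial] using h1
    | cons i l ih =>
      rw [listMonomial_cons, map_mul, List.map_cons, List.sum_cons]
      exact hmul (hv i) ih
  have := h (s.sort (· ≤ ·))
  rwa [← Multiset.sum_coe, ← Multiset.map_coe, Multiset.sort_eq] at this

theorem envelopingMap_ι (M : LieSubalgebra F L) (x : M) :
    envelopingMap M (ι F x) = ι F (x : L) := by
  rw [envelopingMap, lift_ι_apply]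
  rfl

theorem envelopingMap_orderedMonomial {M : LieSubalgebra F L} {J : Set I} (bM : Basis J F M)
    (hb : ∀ j, (bM j : L) = b j) (s : Multiset J) :
    envelopingMap M (orderedMonomial bM s) = orderedMonomial b (s.map Subtype.val) := by
  rw [orderedMonomial, orderedMonomial, ← Multiset.map_sort (r := (· ≤ ·)) (hs := by simp),
    listMonomial, listMonomial, map_list_prod, List.map_map, List.map_map]
  congr 2
  funext j
  simp only [Function.comp_apply, envelopingMap_ι, hb]

/-- The PBW basis of U(M) is carried injectively into the PBW basis of U(L). -/
theorem envelopingMap_injective_of_basis {M : LieSubalgebra F L} {J : Set I} (bM : Basis J F M)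
    (hb : ∀ j, (bM j : L) = b j) : Function.Injective (envelopingMap M) := by
  have h : LinearIndependent F (orderedMonomial b ∘ Multiset.map (Subtype.val : J → I)) :=
    (linearIndependent_orderedMonomial b).comp _ (Multiset.map_injective Subtype.val_injective)
  have hcomb : (envelopingMap M).toLinearMap
      = Finsupp.linearCombination F (orderedMonomial b ∘ Multiset.map (Subtype.val : J → I))
        ∘ₗ (pbwBasis bM).repr.toLinearMap := by
    refine (pbwBasis bM).ext fun s => ?_
    rw [LinearMap.comp_apply, LinearEquiv.coe_coe, Basis.repr_self]
    simp [envelopingMap_orderedMonomial b bM hb]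
  have hinj : Function.Injective (envelopingMap M).toLinearMap := by
    rw [hcomb]
    rw [LinearMap.coe_comp]
    exact Function.Injective.comp (g := Finsupp.linearCombination F _) h
      (pbwBasis bM).repr.injective
  exact hinj

end Spanning

end UniversalEnvelopingAlgebra

open Module

/-! ### Superadditive closures -/

section Growth

theorem sum_map_le_superadditiveClosure (f : ℕ → ℕ) {l : List ℕ} (hl : ∀ k ∈ l, 0 < k) :
    (l.map f).sum ≤ superadditiveClosure f l.sum :=
  Finset.le_sup (f := fun c : Composition l.sum => (c.blocks.map f).sum)
    (Finset.mem_univ ⟨l, fun {k} hk => hl k hk, rfl⟩)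

theorem superadditiveClosure_le_iff {f : ℕ → ℕ} {n a : ℕ} :
    superadditiveClosure f n ≤ a ↔
      ∀ l : List ℕ, (∀ k ∈ l, 0 < k) → l.sum = n → (l.map f).sum ≤ a := by
  constructor
  · rintro h l hl rfl
    exact (sum_map_le_superadditiveClosure f hl).trans h
  · intro h
    exact Finset.sup_le fun c _ => h c.blocks (fun k hk => c.blocks_pos hk) c.blocks_sum

theorem exists_superadditiveClosure_eq (f : ℕ → ℕ) (n : ℕ) :
    ∃ l : List ℕ, (∀ k ∈ l, 0 < k) ∧ l.sum = n ∧ superadditiveClosure f n = (l.map f).sum := by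
  obtain ⟨c, -, hc⟩ := Finset.exists_mem_eq_sup Finset.univ ⟨Composition.ones n, Finset.mem_univ _⟩
    fun c : Composition n => (c.blocks.map f).sum
  exact ⟨c.blocks, fun k hk => c.blocks_pos hk, c.blocks_sum, hc⟩

theorem superadditiveClosure_add_le (f : ℕ → ℕ) (m n : ℕ) :
    superadditiveClosure f m + superadditiveClosure f n ≤ superadditiveClosure f (m + n) := by
  obtain ⟨l, hl, rfl, h⟩ := exists_superadditiveClosure_eq f m
  obtain ⟨l', hl', rfl, h'⟩ := exists_superadditiveClosure_eq f n
  rw [h, h', ← List.sum_append, ← List.map_append, ← List.sum_append]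
  refine sum_map_le_superadditiveClosure f fun k hk => ?_
  exact (List.mem_append.1 hk).elim (hl k) (hl' k)

theorem superadditiveClosure_mono (f : ℕ → ℕ) : Monotone (superadditiveClosure f) := by
  intro m n h
  obtain ⟨k, rfl⟩ := Nat.exists_eq_add_of_le h
  exact (Nat.le_add_right _ _).trans (superadditiveClosure_add_le f m k)

/-- The condition at 0 is needed because the closure is 0 there, as the only sum is empty. -/
theorem le_superadditiveClosure {f : ℕ → ℕ} (h0 : f 0 = 0) (n : ℕ) :
    f n ≤ superadditiveClosure f n := by
  rcases Nat.eq_zero_or_pos n with rfl | hn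
  · simp [h0]
  · simpa using sum_map_le_superadditiveClosure f (l := [n]) (by simpa using hn)

theorem superadditiveClosure_superadditiveClosure (f : ℕ → ℕ) :
    superadditiveClosure (superadditiveClosure f) = superadditiveClosure f := by
  funext n
  refine le_antisymm (superadditiveClosure_le_iff.2 ?_) (le_superadditiveClosure ?_ n)
  · rintro l - rfl
    induction l with
    | nil => simp
    | cons k l ih =>
      rw [List.map_cons, List.sum_cons, List.sum_cons]
      exact (Nat.add_le_add_left ih _).trans (superadditiveClosure_add_le f _ _)
  · obtain ⟨l, hl, hs, h⟩ := exists_superadditiveClosure_eq f 0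
    rcases l with _ | ⟨k, l⟩
    · simpa using h
    · have := hl k (by simp)
      simp at hs
      omega

theorem Majorated.of_le {f g : ℕ → ℕ} (h : ∀ n, f n ≤ g n) : Majorated f g :=
  ⟨1, fun n => by simpa using h n⟩

end Growth

/-! ### Distortion functions and degree filtrations -/

section Filtrations

theorem Submodule.exists_le_of_finiteDimensional {F E : Type*} [Field F] [AddCommGroup E]
    [Module F E] {V : ℕ → Submodule F E} (hV : Monotone V) (hex : ∀ x, ∃ n, x ∈ V n)
    (N : Submodule F E) [FiniteDimensional F N] : ∃ n, N ≤ V n := by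
  obtain ⟨s, rfl⟩ : N.FG := (Submodule.fg_iff_finiteDimensional N).2 ‹_›
  choose k hk using hex
  exact ⟨s.sup k, Submodule.span_le.2 fun x hx => hV (Finset.le_sup hx) (hk x)⟩

section Distortion

variable {F A B : Type*} [Field F] [AddCommGroup A] [Module F A] [AddCommGroup B] [Module F B]
  {φ : B →ₗ[F] A} {α : ℕ → Submodule F A} {β : ℕ → Submodule F B}

/-- The hypothesis rules out the default value 0 of `sInf ∅`. -/
theorem inf_range_le_map_distortion {n : ℕ} (h : ∃ m, α n ⊓ LinearMap.range φ ≤ (β m).map φ) :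
    α n ⊓ LinearMap.range φ ≤ (β (distortion φ α β n)).map φ :=
  Nat.sInf_mem h

theorem distortion_le {n m : ℕ} (h : α n ⊓ LinearMap.range φ ≤ (β m).map φ) :
    distortion φ α β n ≤ m :=
  Nat.sInf_le h

theorem exists_inf_range_le_map (hβ : Monotone β) (hex : ∀ x, ∃ n, x ∈ β n) (n : ℕ)
    [FiniteDimensional F (α n)] : ∃ m, α n ⊓ LinearMap.range φ ≤ (β m).map φ := by
  obtain ⟨N, hN, hNφ⟩ : ∃ N : Submodule F B, FiniteDimensional F N ∧
      N.map φ = α n ⊓ LinearMap.range φ := by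
    -- A linear section of φ over its range lifts the intersection to a finite-dimensional subspace
    -- of B.
    obtain ⟨ψ, hψ⟩ := φ.rangeRestrict.exists_rightInverse_of_surjective φ.range_rangeRestrict
    refine ⟨((α n).comap (LinearMap.range φ).subtype).map ψ, ?_, ?_⟩
    · have : FiniteDimensional F ((α n).comap (LinearMap.range φ).subtype) :=
        FiniteDimensional.of_injective
          (((LinearMap.range φ).subtype.restrict (p := (α n).comap (LinearMap.range φ).subtype)
            (q := α n) fun x hx => hx))
          (fun x y hxy => by
            have := congrArg Subtype.val hxy
            exact Subtype.ext (Subtype.ext this))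
      infer_instance
    · rw [← Submodule.map_comp]
      have : φ ∘ₗ ψ = (LinearMap.range φ).subtype := by
        ext x
        exact congrArg Subtype.val (LinearMap.congr_fun hψ x)
      rw [this, Submodule.map_comap_subtype, inf_comm]
  obtain ⟨m, hm⟩ := Submodule.exists_le_of_finiteDimensional hβ hex N
  exact ⟨m, hNφ ▸ Submodule.map_mono hm⟩

theorem distortion_majorated {α' : ℕ → Submodule F A} {β' : ℕ → Submodule F B} {c d : ℕ}
    (hα : ∀ n, α' n ≤ α (c * n)) (hβ : ∀ n, β n ≤ β' (d * n)) (hα_mono : Monotone α)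
    (h : ∀ n, ∃ m, α n ⊓ LinearMap.range φ ≤ (β m).map φ) :
    Majorated (distortion φ α' β') (distortion φ α β) := by
  have hmono : Monotone (distortion φ α β) := fun m n hmn => distortion_le
    ((inf_le_inf_right _ (hα_mono hmn)).trans (inf_range_le_map_distortion (h n)))
  -- The factor d multiplies the value and c the argument; monotonicity of the distortion allows one
  -- constant for both.
  refine ⟨max c d, fun n => ?_⟩
  have h1 : distortion φ α' β' n ≤ d * distortion φ α β (c * n) := distortion_le <|
    (inf_le_inf_right _ (hα n)).trans <| (inf_range_le_map_distortion (h (c * n))).trans <|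
      Submodule.map_mono (hβ _)
  exact h1.trans (Nat.mul_le_mul (le_max_right _ _)
    (hmono (Nat.mul_le_mul_right n (le_max_left _ _))))

end Distortion

section Assoc

variable {F A : Type*} [Field F] [Ring A] [Algebra F A] (X : Set A)

theorem assocDegreeFiltration_mono : Monotone (assocDegreeFiltration F X) :=
  monotone_nat_of_le_succ fun _ => le_sup_left

theorem one_mem_assocDegreeFiltration : 1 ∈ assocDegreeFiltration F X 0 :=
  Submodule.subset_span rfl

theorem span_pow_le_assocDegreeFiltration (n : ℕ) :
    Submodule.span F X ^ n ≤ assocDegreeFiltration F X n := by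
  cases n with
  | zero => rw [pow_zero, Submodule.one_eq_span]; rfl
  | succ n => exact le_sup_right

theorem subset_assocDegreeFiltration_one : X ⊆ assocDegreeFiltration F X 1 := fun x hx => by
  have h := span_pow_le_assocDegreeFiltration (F := F) X 1
  rw [pow_one] at h
  exact h (Submodule.subset_span hx)

theorem assocDegreeFiltration_mul_le (m n : ℕ) :
    assocDegreeFiltration F X m * assocDegreeFiltration F X n
      ≤ assocDegreeFiltration F X (m + n) := by
  have hpow : ∀ m n, Submodule.span F X ^ m * assocDegreeFiltration F X n
      ≤ assocDegreeFiltration F X (m + n) := by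
    intro m n
    induction n with
    | zero =>
      rw [assocDegreeFiltration, ← Submodule.one_eq_span, mul_one]
      exact span_pow_le_assocDegreeFiltration X m
    | succ n ih =>
      rw [assocDegreeFiltration, Submodule.mul_sup, ← pow_add]
      exact sup_le (ih.trans (assocDegreeFiltration_mono X (by omega)))
        (span_pow_le_assocDegreeFiltration X _)
  induction m with
  | zero => rw [assocDegreeFiltration, ← Submodule.one_eq_span, one_mul, zero_add]
  | succ m ih =>
    rw [assocDegreeFiltration, Submodule.sup_mul]
    exact sup_le (ih.trans (assocDegreeFiltration_mono X (by omega))) (hpow _ _)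

theorem mul_mem_assocDegreeFiltration {m n : ℕ} {x y : A}
    (hx : x ∈ assocDegreeFiltration F X m) (hy : y ∈ assocDegreeFiltration F X n) :
    x * y ∈ assocDegreeFiltration F X (m + n) :=
  assocDegreeFiltration_mul_le X m n (Submodule.mul_mem_mul hx hy)

variable {X}

theorem assocDegreeFiltration_le {G : ℕ → Submodule F A} (hG : Monotone G) (h1 : 1 ∈ G 0)
    (hmul : ∀ {m n x y}, x ∈ G m → y ∈ G n → x * y ∈ G (m + n)) {c : ℕ} (hX : X ⊆ G c) (n : ℕ) :
    assocDegreeFiltration F X n ≤ G (c * n) := by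
  have hpow : ∀ n, Submodule.span F X ^ n ≤ G (c * n) := by
    intro n
    induction n with
    | zero => simpa [Submodule.one_eq_span] using h1
    | succ n ih =>
      rw [pow_succ, mul_add, mul_one]
      exact Submodule.mul_le.2 fun x hx y hy => hmul (ih hx) (Submodule.span_le.2 hX hy)
  induction n with
  | zero => simpa [assocDegreeFiltration] using h1
  | succ n ih => exact sup_le (ih.trans (hG (Nat.mul_le_mul_left c n.le_succ))) (hpow _)

theorem exists_mem_assocDegreeFiltration (hX : Algebra.adjoin F X = ⊤) (x : A) :
    ∃ n, x ∈ assocDegreeFiltration F X n := by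
  have hx : x ∈ Algebra.adjoin F X := hX ▸ trivial
  induction hx using Algebra.adjoin_induction with
  | mem x hx => exact ⟨1, subset_assocDegreeFiltration_one X hx⟩
  | algebraMap r =>
    refine ⟨0, ?_⟩
    rw [Algebra.algebraMap_eq_smul_one]
    exact Submodule.smul_mem _ _ (one_mem_assocDegreeFiltration X)
  | add x y _ _ hx hy =>
    obtain ⟨m, hm⟩ := hx
    obtain ⟨n, hn⟩ := hy
    exact ⟨max m n, add_mem (assocDegreeFiltration_mono X (le_max_left m n) hm)
      (assocDegreeFiltration_mono X (le_max_right m n) hn)⟩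
  | mul x y _ _ hx hy =>
    obtain ⟨m, hm⟩ := hx
    obtain ⟨n, hn⟩ := hy
    exact ⟨m + n, mul_mem_assocDegreeFiltration X hm hn⟩

theorem exists_assocDegreeFiltration_le {Y : Set A} (hX : X.Finite)
    (hY : Algebra.adjoin F Y = ⊤) :
    ∃ c, ∀ n, assocDegreeFiltration F X n ≤ assocDegreeFiltration F Y (c * n) := by
  choose k hk using exists_mem_assocDegreeFiltration hY
  refine ⟨hX.toFinset.sup k, fun n => assocDegreeFiltration_le (assocDegreeFiltration_mono Y)
    (one_mem_assocDegreeFiltration Y) (mul_mem_assocDegreeFiltration Y) (fun x hx => ?_) n⟩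
  exact assocDegreeFiltration_mono Y (Finset.le_sup (hX.mem_toFinset.2 hx)) (hk x)

end Assoc

section Lie

variable {F L : Type*} [Field F] [LieRing L] [LieAlgebra F L] (X : Set L)

theorem IsLieMonomial.pos {X : Set L} {k : ℕ} {a : L} (h : IsLieMonomial X k a) : 0 < k := by
  induction h <;> omega

theorem lieDegreeFiltration_mono : Monotone (lieDegreeFiltration F X) := fun _ _ h =>
  Submodule.span_mono fun _ ⟨k, hk, ha⟩ => ⟨k, hk.trans h, ha⟩

theorem lieDegreeFiltration_zero : lieDegreeFiltration F X 0 = ⊥ := by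
  rw [lieDegreeFiltration, Submodule.span_eq_bot]
  rintro a ⟨k, hk, ha⟩
  have := ha.pos
  omega

theorem subset_lieDegreeFiltration_one : X ⊆ lieDegreeFiltration F X 1 := fun x hx =>
  Submodule.subset_span ⟨1, le_rfl, .of x hx⟩

variable {X}

theorem lie_mem_lieDegreeFiltration {m n : ℕ} {x y : L} (hx : x ∈ lieDegreeFiltration F X m)
    (hy : y ∈ lieDegreeFiltration F X n) : ⁅x, y⁆ ∈ lieDegreeFiltration F X (m + n) := by
  induction hx, hy using Submodule.span_induction₂ with
  | mem_mem x y hx hy =>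
    obtain ⟨i, hi, hx⟩ := hx
    obtain ⟨j, hj, hy⟩ := hy
    exact Submodule.subset_span ⟨i + j, add_le_add hi hj, .lie i j x y hx hy⟩
  | zero_left => simp
  | zero_right => simp
  | add_left x y z _ _ _ h h' => rw [add_lie]; exact add_mem h h'
  | add_right x y z _ _ _ h h' => rw [lie_add]; exact add_mem h h'
  | smul_left c x y _ _ h => rw [smul_lie]; exact Submodule.smul_mem _ _ h
  | smul_right c x y _ _ h => rw [lie_smul]; exact Submodule.smul_mem _ _ h

theorem exists_mem_lieDegreeFiltration (hX : LieSubalgebra.lieSpan F L X = ⊤) (x : L) :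
    ∃ n, x ∈ lieDegreeFiltration F X n := by
  have hx : x ∈ LieSubalgebra.lieSpan F L X := hX ▸ trivial
  induction hx using LieSubalgebra.lieSpan_induction with
  | mem x hx => exact ⟨1, subset_lieDegreeFiltration_one X hx⟩
  | zero => exact ⟨0, zero_mem _⟩
  | add x y _ _ hx hy =>
    obtain ⟨m, hm⟩ := hx
    obtain ⟨n, hn⟩ := hy
    exact ⟨max m n, add_mem (lieDegreeFiltration_mono X (le_max_left m n) hm)
      (lieDegreeFiltration_mono X (le_max_right m n) hn)⟩
  | smul c x _ hx =>
    obtain ⟨m, hm⟩ := hx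
    exact ⟨m, Submodule.smul_mem _ _ hm⟩
  | lie x y _ _ hx hy =>
    obtain ⟨m, hm⟩ := hx
    obtain ⟨n, hn⟩ := hy
    exact ⟨m + n, lie_mem_lieDegreeFiltration hm hn⟩

theorem finite_isLieMonomial (hX : X.Finite) (k : ℕ) : {a | IsLieMonomial X k a}.Finite := by
  induction k using Nat.strong_induction_on with
  | _ k ih =>
    have h : {a | IsLieMonomial X k a} ⊆ X ∪ ⋃ i ∈ Set.Iio k, ⋃ j ∈ Set.Iio k,
        Set.image2 (fun a b => ⁅a, b⁆) {a | IsLieMonomial X i a} {a | IsLieMonomial X j a} := by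
      intro a ha
      cases ha with
      | of x hx => exact Or.inl hx
      | lie i j a b ha hb =>
        have := ha.pos
        have := hb.pos
        refine Or.inr ?_
        simp only [Set.mem_iUnion]
        exact ⟨i, Set.mem_Iio.2 (by omega), j, Set.mem_Iio.2 (by omega), a, ha, b, hb, rfl⟩
    refine (hX.union ?_).subset h
    exact (Set.finite_Iio k).biUnion fun i hi => (Set.finite_Iio k).biUnion fun j hj =>
      (ih i hi).image2 _ (ih j hj)

theorem finiteDimensional_lieDegreeFiltration (hX : X.Finite) (n : ℕ) :
    FiniteDimensional F (lieDegreeFiltration F X n) := by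
  refine FiniteDimensional.span_of_finite F ?_
  refine ((Set.finite_Iic n).biUnion fun k _ => finite_isLieMonomial hX k).subset ?_
  rintro a ⟨k, hk, ha⟩
  simp only [Set.mem_iUnion]
  exact ⟨k, hk, ha⟩

theorem ι_mem_assocDegreeFiltration {n : ℕ} {x : L} (hx : x ∈ lieDegreeFiltration F X n) :
    UniversalEnvelopingAlgebra.ι F x
      ∈ assocDegreeFiltration F (UniversalEnvelopingAlgebra.ι F '' X) n := by
  induction hx using Submodule.span_induction with
  | mem x hx =>
    obtain ⟨k, hk, hx⟩ := hx
    refine assocDegreeFiltration_mono _ hk ?_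
    clear hk
    induction hx with
    | of x hx => exact subset_assocDegreeFiltration_one _ ⟨x, hx, rfl⟩
    | lie i j a b _ _ ha hb =>
      rw [LieHom.map_lie, LieRing.of_associative_ring_bracket]
      refine sub_mem (mul_mem_assocDegreeFiltration _ ha hb) ?_
      rw [add_comm]
      exact mul_mem_assocDegreeFiltration _ hb ha
  | zero => simp
  | add x y _ _ hx hy => rw [map_add]; exact add_mem hx hy
  | smul c x _ hx => rw [map_smul]; exact Submodule.smul_mem _ _ hx

end Lie

end Filtrations

/-! ### Bases adapted to a filtration -/

section AdaptedBasis

variable {F E : Type*} [Field F] [AddCommGroup E] [Module F E] {V : ℕ → Submodule F E}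

/-- A basis adapted to a filtration, chosen so that modulo the preceding term of the filtration it
meets prescribed subsets in spanning sets of them. -/
theorem exists_linearIndepOn_adapted (hV : Monotone V) (h0 : V 0 = ⊥) (P : ℕ → Set E)
    (hP : ∀ n, P n ⊆ V (n + 1)) :
    ∃ S : Set E, LinearIndepOn F id S ∧ (∀ n, V n = Submodule.span F (S ∩ V n)) ∧
      ∀ n, P n ⊆ Submodule.span F (V n ∪ (S ∩ P n)) := by
  let Stage (n : ℕ) := {T : Set E // LinearIndepOn F id T ∧ Submodule.span F T = V n}
  have step : ∀ (n : ℕ) (T : Stage n), ∃ T' : Stage (n + 1), T.1 ⊆ T'.1 ∧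
      P n ⊆ Submodule.span F (V n ∪ (T'.1 ∩ P n)) := by
    rintro n ⟨T, hT, hTV⟩
    have hTn : T ⊆ V (n + 1) := fun x hx => hV n.le_succ (hTV ▸ Submodule.subset_span hx)
    -- Extending first inside `T ∪ P n`, and only then inside `V (n + 1)`, gives the vectors of `P
    -- n` priority.
    have h1 := hT.linearIndepOn_extend (Set.subset_union_left (t := P n))
    have h1V : hT.extend (Set.subset_union_left (t := P n)) ⊆ V (n + 1) :=
      (hT.extend_subset _).trans (Set.union_subset hTn (hP n))
    refine ⟨⟨h1.extend h1V, h1.linearIndepOn_extend h1V, ?_⟩, ?_, ?_⟩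
    · rw [h1.span_extend_eq_span, Submodule.span_eq]
    · exact (hT.subset_extend _).trans (h1.subset_extend h1V)
    · intro x hx
      have hx' := hT.subset_span_extend (Set.subset_union_left (t := P n)) (Or.inr hx)
      refine Submodule.span_mono ?_ hx'
      intro y hy
      rcases hT.extend_subset _ hy with hyT | hyP
      · exact Or.inl (hTV ▸ Submodule.subset_span hyT)
      · exact Or.inr ⟨h1.subset_extend h1V hy, hyP⟩
  choose next hnext hnextP using step
  let stage : ∀ n, Stage n := fun n =>
    Nat.rec ⟨∅, linearIndepOn_empty F id, by rw [Submodule.span_empty, h0]⟩ next n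
  have hmono : Monotone fun n => (stage n).1 := monotone_nat_of_le_succ fun n => hnext n (stage n)
  refine ⟨⋃ n, (stage n).1, linearIndepOn_iUnion_of_directed hmono.directed_le
    fun n => (stage n).2.1, fun n => le_antisymm ?_ (Submodule.span_le.2 Set.inter_subset_right),
    fun n => (hnextP n (stage n)).trans (Submodule.span_mono ?_)⟩
  · conv_lhs => rw [← (stage n).2.2]
    exact Submodule.span_mono fun x hx =>
      ⟨Set.mem_iUnion.2 ⟨n, hx⟩, (stage n).2.2 ▸ Submodule.subset_span hx⟩
  · exact Set.union_subset_union_right _ (Set.inter_subset_inter_left _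
      (Set.subset_iUnion (fun n => (stage n).1) (n + 1)))

/-- The index of the first term of a filtration that contains a vector. -/
noncomputable def filtrationOrder (V : ℕ → Submodule F E) (x : E) : ℕ := sInf {n | x ∈ V n}

theorem filtrationOrder_le_iff (hV : Monotone V) (hex : ∀ x, ∃ n, x ∈ V n) {x : E} {n : ℕ} :
    filtrationOrder V x ≤ n ↔ x ∈ V n :=
  ⟨fun h => hV h (Nat.sInf_mem (hex x)), fun h => Nat.sInf_le h⟩

theorem mem_filtrationOrder (hex : ∀ x, ∃ n, x ∈ V n) (x : E) : x ∈ V (filtrationOrder V x) :=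
  Nat.sInf_mem (hex x)

end AdaptedBasis

open Module UniversalEnvelopingAlgebra

section AdaptedBases

variable {F E : Type*} [Field F] [AddCommGroup E] [Module F E] {V : ℕ → Submodule F E}

/-- The vectors of a linearly independent set adapted to an exhaustive filtration form a basis. -/
noncomputable def adaptedBasis (hex : ∀ x, ∃ n, x ∈ V n) {S : Set E}
    (hS : LinearIndepOn F id S) (hSV : ∀ n, V n = Submodule.span F (S ∩ V n)) : Basis S F E :=
  Basis.mk (v := Subtype.val) hS fun x _ => by
    obtain ⟨n, hn⟩ := hex x
    rw [hSV n] at hn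
    rw [Subtype.range_coe]
    exact Submodule.span_mono Set.inter_subset_left hn

theorem adaptedBasis_apply (hex : ∀ x, ∃ n, x ∈ V n) {S : Set E}
    (hS : LinearIndepOn F id S) (hSV : ∀ n, V n = Submodule.span F (S ∩ V n)) (s : S) :
    adaptedBasis hex hS hSV s = s :=
  Basis.mk_apply (v := (Subtype.val : S → E)) hS _ s

theorem eq_span_adaptedBasis (hV : Monotone V) (hex : ∀ x, ∃ n, x ∈ V n) {S : Set E}
    (hS : LinearIndepOn F id S) (hSV : ∀ n, V n = Submodule.span F (S ∩ V n)) (n : ℕ) :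
    V n = Submodule.span F
      (adaptedBasis hex hS hSV '' {s | filtrationOrder V (s : E) ≤ n}) := by
  conv_lhs => rw [hSV n]
  congr 1
  ext x
  simp only [Set.mem_inter_iff, Set.mem_image, Set.mem_ofPred, adaptedBasis_apply,
    filtrationOrder_le_iff hV hex, SetLike.mem_coe]
  exact ⟨fun h => ⟨⟨x, h.1⟩, h.2, rfl⟩, fun ⟨s, hs, hx⟩ => hx ▸ ⟨s.2, hs⟩⟩

/-- There is a basis adapted to a filtration that contains a basis of a given subspace. -/
theorem exists_adapted_basis_submodule (hV : Monotone V) (h0 : V 0 = ⊥)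
    (hex : ∀ x, ∃ n, x ∈ V n) (M : Submodule F E) :
    ∃ (S : Set E) (b : Basis S F E) (J : Set S) (c : Basis J F M),
      (∀ n, V n = Submodule.span F (b '' {s | filtrationOrder V (b s) ≤ n})) ∧
        ∀ j, (c j : E) = b j := by
  obtain ⟨S, hS, hSV, hSP⟩ := exists_linearIndepOn_adapted hV h0 (fun n => V (n + 1) ∩ M)
    fun n => Set.inter_subset_left
  -- An element of `V (n + 1) ⊓ M` is a combination of vectors of S in M plus a remainder in `V n`;
  -- the remainder is again in M, so induction applies.
  have hspan : ∀ n, V n ⊓ M ≤ Submodule.span F (S ∩ M) := by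
    intro n
    induction n with
    | zero => simp [h0]
    | succ n ih =>
      rintro x hx
      have hx' := hSP n hx
      rw [SetLike.mem_coe, Submodule.span_union, Submodule.span_eq, Submodule.mem_sup] at hx'
      obtain ⟨v, hv, p, hp, rfl⟩ := hx'
      have hpM : p ∈ M := by
        refine (Submodule.span_le (p := M)).2 (fun y hy => ?_) hp
        exact hy.2.2
      have hvM : v ∈ M := by simpa using M.sub_mem hx.2 hpM
      exact add_mem (ih ⟨hv, hvM⟩)
        (Submodule.span_mono (Set.inter_subset_inter_right _ Set.inter_subset_right) hp)
  let b := adaptedBasis hex hS hSV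
  have hb : ∀ s, b s = s := adaptedBasis_apply hex hS hSV
  let J : Set S := {s | (s : E) ∈ M}
  let c (j : J) : M := ⟨(j : S), j.2⟩
  have hc : LinearIndependent F c := by
    refine LinearIndependent.of_comp M.subtype ?_
    exact LinearIndependent.comp hS (Subtype.val : J → S) Subtype.val_injective
  have hct : ⊤ ≤ Submodule.span F (Set.range c) := by
    rintro ⟨x, hxM⟩ -
    obtain ⟨n, hn⟩ := hex x
    have hx := hspan n ⟨hn, hxM⟩
    have himage : S ∩ M = M.subtype '' Set.range c := by
      ext y
      constructor
      · rintro ⟨h1, h2⟩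
        exact ⟨⟨y, h2⟩, ⟨⟨⟨y, h1⟩, h2⟩, rfl⟩, rfl⟩
      · rintro ⟨_, ⟨j, rfl⟩, rfl⟩
        exact ⟨j.1.2, j.2⟩
    rw [himage, Submodule.span_image] at hx
    obtain ⟨y, hy, hyx⟩ := hx
    obtain rfl : y = ⟨x, hxM⟩ := Subtype.ext hyx
    exact hy
  refine ⟨S, b, J, Basis.mk hc hct, fun n => ?_, fun j => by simp [hb, c]⟩
  conv_lhs => rw [eq_span_adaptedBasis hV hex hS hSV n]
  simp only [hb, b]

/-- There is a basis adapted to a filtration that contains given vectors of distinct positive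
orders. -/
theorem exists_adapted_basis_mem (hV : Monotone V) (h0 : V 0 = ⊥)
    (hex : ∀ x, ∃ n, x ∈ V n) (D : Set ℕ) (a : ℕ → E)
    (ha : ∀ n ∈ D, a n ∈ V (n + 1)) (ha' : ∀ n ∈ D, a n ∉ V n) :
    ∃ (S : Set E) (b : Basis S F E),
      (∀ n, V n = Submodule.span F (b '' {s | filtrationOrder V (b s) ≤ n})) ∧
        ∀ n ∈ D, ∃ s, b s = a n := by
  obtain ⟨S, hS, hSV, hSP⟩ := exists_linearIndepOn_adapted hV h0 (fun n => {x | n ∈ D ∧ a n = x})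
    (by rintro n _ ⟨hn, rfl⟩; exact ha n hn)
  have hb := adaptedBasis_apply hex hS hSV
  refine ⟨S, adaptedBasis hex hS hSV, fun n => ?_, fun n hn => ?_⟩
  · simpa only [hb] using eq_span_adaptedBasis hV hex hS hSV n
  -- If `a n` were not in S, the set S would miss the singleton prescribed at stage n, and `a n`
  -- would already lie in `V n`.
  · by_contra hcon
    have h := hSP n ⟨hn, rfl⟩
    have hempty : S ∩ {x | n ∈ D ∧ a n = x} = ∅ := by
      refine Set.eq_empty_of_forall_notMem ?_
      rintro x ⟨hx, -, rfl⟩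
      exact hcon ⟨⟨_, hx⟩, hb _⟩
    rw [hempty, Set.union_empty, SetLike.mem_coe, Submodule.span_eq] at h
    exact ha' n hn h

end AdaptedBases

/-! ### Comparison of the two distortion functions -/

section Enveloping

variable {F L : Type*} [Field F] [LieRing L] [LieAlgebra F L] {X : Set L}

/-- The degree filtration of the universal enveloping algebra is spanned by the ordered monomials
of bounded weight. -/
theorem assocDegreeFiltration_eq_weightSpan {I : Type*} [LinearOrder I] {b : Basis I F L}
    {w : I → ℕ} (hb : ∀ n, lieDegreeFiltration F X n = Submodule.span F (b '' {i | w i ≤ n}))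
    (n : ℕ) : assocDegreeFiltration F (ι F '' X) n = weightSpan b w n := by
  have hmem : ∀ i, b i ∈ lieDegreeFiltration F X (w i) := fun i =>
    hb (w i) ▸ Submodule.subset_span ⟨i, Set.mem_ofPred.2 le_rfl, rfl⟩
  have hw : ∀ i j, ⁅b i, b j⁆ ∈ Submodule.span F (b '' {k | w k ≤ w i + w j}) := fun i j =>
    hb (w i + w j) ▸ lie_mem_lieDegreeFiltration (hmem i) (hmem j)
  -- The weight spans are a multiplicative filtration with ι(X) in term 1, hence contain the degree
  -- filtration; conversely a basis vector of weight k has degree at most k in U(L).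
  apply le_antisymm
  · have h := assocDegreeFiltration_le (X := ι F '' X) (weightSpan_mono b w)
      (one_mem_weightSpan b w) (mul_mem_weightSpan hw) (c := 1) ?_ n
    · rwa [one_mul] at h
    · rintro _ ⟨x, hx, rfl⟩
      exact ι_mem_weightSpan (hb 1 ▸ subset_lieDegreeFiltration_one X hx)
  · rw [weightSpan, Submodule.span_le]
    rintro _ ⟨s, hs, rfl⟩
    exact assocDegreeFiltration_mono _ hs <|
      map_orderedMonomial_mem b (AlgHom.id F _) (one_mem_assocDegreeFiltration (ι F '' X))
        (mul_mem_assocDegreeFiltration _) w (fun i => ι_mem_assocDegreeFiltration (hmem i)) s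

theorem adjoin_image_ι_eq_top (hX : LieSubalgebra.lieSpan F L X = ⊤) :
    Algebra.adjoin F (ι F '' X) = ⊤ := by
  rw [eq_top_iff, ← adjoin_range_ι, Algebra.adjoin_le_iff]
  rintro _ ⟨x, rfl⟩
  have hx : x ∈ LieSubalgebra.lieSpan F L X := hX ▸ LieSubalgebra.mem_top x
  induction hx using LieSubalgebra.lieSpan_induction with
  | mem x hx => exact Algebra.subset_adjoin ⟨x, hx, rfl⟩
  | zero => rw [map_zero]; exact zero_mem _
  | add x y _ _ hx hy => rw [map_add]; exact add_mem hx hy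
  | smul c x _ hx => rw [map_smul]; exact Subalgebra.smul_mem _ hx c
  | lie x y _ _ hx hy =>
    rw [LieHom.map_lie, LieRing.of_associative_ring_bracket]
    exact sub_mem (mul_mem hx hy) (mul_mem hy hx)

variable (M : LieSubalgebra F L) {Y : Set M}

theorem envelopingMap_injective : Function.Injective (envelopingMap M) := by
  -- For the filtration that jumps from 0 to L, this just extends a basis of M to one of L.
  obtain ⟨S, b, J, c, -, hc⟩ := exists_adapted_basis_submodule (F := F) (E := L)
    (V := fun n => if n = 0 then ⊥ else ⊤)
    (by
      intro m n h
      rcases Nat.eq_zero_or_pos m with rfl | hm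
      · simp
      · have : n ≠ 0 := by omega
        simp [this])
    (by simp) (fun x => ⟨1, by simp⟩) M.toSubmodule
  let _ : LinearOrder S := IsWellOrder.linearOrder WellOrderingRel
  exact envelopingMap_injective_of_basis b (M := M) c hc

variable {M}

variable (X Y) in
/-- The distortion function of `M` in `L`. -/
noncomputable abbrev lieDistortionFun : ℕ → ℕ :=
  distortion (M.incl : M →ₗ[F] L) (lieDegreeFiltration F X) (lieDegreeFiltration F Y)

variable (X Y) in
/-- The distortion function of `U(M)` in `U(L)` for generating sets coming from `M` and `L`. -/
noncomputable abbrev envelopingDistortionFun : ℕ → ℕ :=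
  distortion (envelopingMap M).toLinearMap (assocDegreeFiltration F (ι F '' X))
    (assocDegreeFiltration F (ι F '' Y))

theorem exists_lieDegreeFiltration_inf_range_le (hX : X.Finite)
    (hY : LieSubalgebra.lieSpan F M Y = ⊤) (n : ℕ) :
    ∃ m, lieDegreeFiltration F X n ⊓ LinearMap.range (M.incl : M →ₗ[F] L)
      ≤ (lieDegreeFiltration F Y m).map (M.incl : M →ₗ[F] L) :=
  have := finiteDimensional_lieDegreeFiltration (F := F) hX n
  exists_inf_range_le_map (lieDegreeFiltration_mono Y) (exists_mem_lieDegreeFiltration hY) n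

theorem mem_lieDegreeFiltration_distortion (hX : X.Finite)
    (hY : LieSubalgebra.lieSpan F M Y = ⊤) {n : ℕ} {x : M}
    (hx : (x : L) ∈ lieDegreeFiltration F X n) :
    x ∈ lieDegreeFiltration F Y (lieDistortionFun X Y n) := by
  obtain ⟨y, hy, hyx⟩ := inf_range_le_map_distortion
    (exists_lieDegreeFiltration_inf_range_le hX hY n) ⟨hx, ⟨x, rfl⟩⟩
  obtain rfl : y = x := Subtype.ext hyx
  exact hy

/-- The upper bound, from a basis of L adapted to X and to M simultaneously. -/
theorem assocDegreeFiltration_inf_range_le (hX : X.Finite)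
    (hXgen : LieSubalgebra.lieSpan F L X = ⊤) (hYgen : LieSubalgebra.lieSpan F M Y = ⊤) (n : ℕ) :
    assocDegreeFiltration F (ι F '' X) n ⊓ LinearMap.range (envelopingMap M).toLinearMap
      ≤ (assocDegreeFiltration F (ι F '' Y) (superadditiveClosure (lieDistortionFun X Y) n)).map
        (envelopingMap M).toLinearMap := by
  obtain ⟨S, b, J, c₀, hb, hc⟩ := exists_adapted_basis_submodule (lieDegreeFiltration_mono X)
    (lieDegreeFiltration_zero X) (exists_mem_lieDegreeFiltration hXgen) M.toSubmodule
  let c : Basis J F M := c₀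
  replace hc : ∀ j, (c j : L) = b j := hc
  let _ : LinearOrder S := IsWellOrder.linearOrder WellOrderingRel
  set w : S → ℕ := fun s => filtrationOrder (lieDegreeFiltration F X) (b s)
  have hmem : ∀ s, b s ∈ lieDegreeFiltration F X (w s) := fun s =>
    mem_filtrationOrder (exists_mem_lieDegreeFiltration hXgen) _
  -- The closure admits only positive parts; weights are positive because the 0-th term of L is
  -- zero.
  have hpos : ∀ s, 0 < w s := by
    intro s
    refine Nat.pos_of_ne_zero fun h => b.ne_zero s ?_
    have := hmem s
    rwa [h, lieDegreeFiltration_zero, Submodule.mem_bot] at this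
  rintro u ⟨hu, hv⟩
  rw [SetLike.mem_coe, assocDegreeFiltration_eq_weightSpan hb, weightSpan, ← coe_pbwBasis,
    Basis.mem_span_image] at hu
  have hv' : u ∈ Submodule.span F
      (pbwBasis b '' Set.range (Multiset.map (Subtype.val : J → S))) := by
    rw [SetLike.mem_coe, LinearMap.range_eq_map, ← span_range_orderedMonomial c,
      Submodule.map_span] at hv
    refine Submodule.span_mono ?_ hv
    rintro _ ⟨_, ⟨s, rfl⟩, rfl⟩
    refine ⟨s.map Subtype.val, ⟨s, rfl⟩, ?_⟩
    rw [coe_pbwBasis]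
    exact (envelopingMap_orderedMonomial b c hc s).symm
  rw [Basis.mem_span_image] at hv'
  -- The PBW coordinates of u are unique, so its monomials satisfy both conditions at once: weight
  -- at most n and all factors in M.
  refine Submodule.span_le.2 ?_ ((Basis.mem_span_image (pbwBasis b)).2 (Set.subset_inter hu hv'))
  rintro _ ⟨_, ⟨hs, s, rfl⟩, rfl⟩
  refine ⟨orderedMonomial c s, ?_, by
    rw [coe_pbwBasis]; exact envelopingMap_orderedMonomial b c hc s⟩
  have h1 := map_orderedMonomial_mem c (AlgHom.id F _)
    (one_mem_assocDegreeFiltration (F := F) (ι F '' Y)) (mul_mem_assocDegreeFiltration _)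
    (fun j => lieDistortionFun X Y (w j)) (fun j => ι_mem_assocDegreeFiltration
      (mem_lieDegreeFiltration_distortion hX hYgen (hc j ▸ hmem j))) s
  refine assocDegreeFiltration_mono _ ?_ h1
  have h2 := sum_map_le_superadditiveClosure (lieDistortionFun X Y)
    (l := (s.map fun j : J => w j.1).toList) (fun k hk => by
      obtain ⟨j, -, rfl⟩ := Multiset.mem_map.1 (Multiset.mem_toList.1 hk)
      exact hpos _)
  rw [← Multiset.sum_coe, ← Multiset.map_coe, Multiset.coe_toList, Multiset.map_map,
    Multiset.sum_toList] at h2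
  refine h2.trans (superadditiveClosure_mono _ ?_)
  have hs' := Set.mem_ofPred.1 hs
  rw [Multiset.map_map] at hs'
  exact hs'

/-- A witness at the least n with value m + 1 works for every such n, since the filtration of L
increases. One vector per value keeps the orders of the chosen vectors distinct. -/
theorem exists_mem_notMem_of_lieDistortionFun_eq (m : ℕ)
    (hm : ∃ n, lieDistortionFun X Y n = m + 1) :
    ∃ a : M, (∀ n, lieDistortionFun X Y n = m + 1 → (a : L) ∈ lieDegreeFiltration F X n) ∧
      a ∉ lieDegreeFiltration F Y m := by
  have hk : lieDistortionFun X Y (sInf {n | lieDistortionFun X Y n = m + 1}) = m + 1 :=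
    Nat.sInf_mem hm
  generalize hk' : sInf {n | lieDistortionFun X Y n = m + 1} = k at hk
  have hnot : ¬ lieDegreeFiltration F X k ⊓ LinearMap.range (M.incl : M →ₗ[F] L)
      ≤ (lieDegreeFiltration F Y m).map (M.incl : M →ₗ[F] L) := fun h => by
    have : lieDistortionFun X Y k ≤ m := distortion_le h
    omega
  obtain ⟨_, ⟨hx, a, rfl⟩, ha⟩ := SetLike.not_le_iff_exists.1 hnot
  refine ⟨a, fun n hn => lieDegreeFiltration_mono X ?_ hx, fun h => ha ⟨a, h, rfl⟩⟩
  rw [← hk']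
  exact Nat.sInf_le hn

/-- The lower bound: a monomial in the chosen witnesses has small degree in U(L) but weight in U(M)
equal to the given sum. -/
theorem superadditiveClosure_le_envelopingDistortionFun (hX : X.Finite)
    (hXgen : LieSubalgebra.lieSpan F L X = ⊤) (hYgen : LieSubalgebra.lieSpan F M Y = ⊤) (n : ℕ) :
    superadditiveClosure (lieDistortionFun X Y) n ≤ envelopingDistortionFun X Y n := by
  set δ := lieDistortionFun X Y with hδ
  have hex : ∀ m ∈ {m | ∃ n, δ n = m + 1}, ∃ a : M,
      (∀ n, δ n = m + 1 → (a : L) ∈ lieDegreeFiltration F X n) ∧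
        a ∉ lieDegreeFiltration F Y m := exists_mem_notMem_of_lieDistortionFun_eq
  choose! a ha ha' using hex
  obtain ⟨S, b, hb, hS⟩ := exists_adapted_basis_mem (lieDegreeFiltration_mono (F := F) Y)
    (lieDegreeFiltration_zero Y) (exists_mem_lieDegreeFiltration hYgen) {m | ∃ n, δ n = m + 1} a
    (by
      rintro m ⟨n, hn⟩
      have := mem_lieDegreeFiltration_distortion hX hYgen (ha m ⟨n, hn⟩ n hn)
      rwa [← hδ, hn] at this) ha'
  let _ : LinearOrder S := IsWellOrder.linearOrder WellOrderingRel
  set w : S → ℕ := fun s => filtrationOrder (lieDegreeFiltration F Y) (b s)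
  let v : S → ℕ := fun s => filtrationOrder (lieDegreeFiltration F X) (b s : L)
  have hL := fun (x : L) (n : ℕ) => filtrationOrder_le_iff (lieDegreeFiltration_mono (F := F) X)
    (exists_mem_lieDegreeFiltration hXgen) (x := x) (n := n)
  have hM := fun (x : M) (n : ℕ) => filtrationOrder_le_iff (lieDegreeFiltration_mono (F := F) Y)
    (exists_mem_lieDegreeFiltration hYgen) (x := x) (n := n)
  have hbasis : ∀ n m, δ n = m + 1 → ∃ s, w s = m + 1 ∧ v s ≤ n := by
    intro n m hn
    obtain ⟨s, hs⟩ := hS m ⟨n, hn⟩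
    have haL := ha m ⟨n, hn⟩ n hn
    refine ⟨s, le_antisymm ?_ (Nat.succ_le_of_lt (not_le.1 fun h => ?_)), ?_⟩
    · rw [hM, hs, ← hn]
      exact mem_lieDegreeFiltration_distortion hX hYgen haL
    · rw [hM, hs] at h
      exact ha' m ⟨n, hn⟩ h
    · rw [hL, hs]
      exact haL
  -- Each part with positive distortion contributes its witness; parts with distortion 0 contribute
  -- no factor.
  have hlist : ∀ l : List ℕ, ∃ t : Multiset S,
      (t.map w).sum = (l.map δ).sum ∧ (t.map v).sum ≤ l.sum := by
    intro l
    induction l with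
    | nil => exact ⟨0, by simp⟩
    | cons n l ih =>
      obtain ⟨t, ht, ht'⟩ := ih
      rcases hn : δ n with _ | m
      · exact ⟨t, by simp [hn, ht], by simp only [List.sum_cons]; omega⟩
      · obtain ⟨s, hs, hs'⟩ := hbasis n m hn
        exact ⟨s ::ₘ t, by simp [hn, ht, hs], by
          simp only [Multiset.map_cons, Multiset.sum_cons, List.sum_cons]
          omega⟩
  refine superadditiveClosure_le_iff.2 ?_
  rintro l - rfl
  obtain ⟨t, ht, ht'⟩ := hlist l
  have h1 := map_orderedMonomial_mem b (envelopingMap M)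
    (one_mem_assocDegreeFiltration (F := F) (ι F '' X)) (mul_mem_assocDegreeFiltration _) v
    (fun s => by
      rw [envelopingMap_ι]
      exact ι_mem_assocDegreeFiltration ((hL _ _).1 le_rfl)) t
  obtain ⟨y, hy, hyt⟩ := inf_range_le_map_distortion (φ := (envelopingMap M).toLinearMap)
    (β := assocDegreeFiltration F (ι F '' Y))
    ⟨_, assocDegreeFiltration_inf_range_le hX hXgen hYgen l.sum⟩
    ⟨assocDegreeFiltration_mono _ ht' h1, ⟨_, rfl⟩⟩
  -- By injectivity the preimage supplied by the distortion is the monomial itself, whose order is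
  -- its weight.
  obtain rfl := envelopingMap_injective M hyt
  rw [SetLike.mem_coe, assocDegreeFiltration_eq_weightSpan hb,
    orderedMonomial_mem_weightSpan_iff, ht] at hy
  exact hy

theorem envelopingDistortionFun_eq (hX : X.Finite) (hXgen : LieSubalgebra.lieSpan F L X = ⊤)
    (hYgen : LieSubalgebra.lieSpan F M Y = ⊤) :
    envelopingDistortionFun X Y = superadditiveClosure (lieDistortionFun X Y) :=
  funext fun n => le_antisymm
    (distortion_le (assocDegreeFiltration_inf_range_le hX hXgen hYgen n))
    (superadditiveClosure_le_envelopingDistortionFun hX hXgen hYgen n)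

theorem lieDistortionFun_zero : lieDistortionFun X Y 0 = 0 :=
  Nat.le_zero.1 <| distortion_le <| by rw [lieDegreeFiltration_zero]; simp

end Enveloping

/-! ### Independence of the generating sets and conclusion -/

theorem theorem2p10 {F L : Type*} [Field F] [LieRing L] [LieAlgebra F L]
    (M : LieSubalgebra F L)
    (X : Set L) (hX : X.Finite) (hXgen : LieSubalgebra.lieSpan F L X = ⊤)
    (Y : Set M) (hY : Y.Finite) (hYgen : LieSubalgebra.lieSpan F M Y = ⊤)
    (X' : Set (UniversalEnvelopingAlgebra F L)) (hX' : X'.Finite)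
    (hX'gen : Algebra.adjoin F X' = ⊤)
    (Y' : Set (UniversalEnvelopingAlgebra F M)) (hY' : Y'.Finite)
    (hY'gen : Algebra.adjoin F Y' = ⊤) :
    Function.Injective (envelopingMap M) ∧
      assocDistortion (envelopingMap M) X' Y' = (lieDistortion M X Y).closure ∧
      lieDistortion M X Y ≤ assocDistortion (envelopingMap M) X' Y' ∧
      (assocDistortion (envelopingMap M) X' Y').IsSuperadditive := by
  obtain ⟨c, hc⟩ := exists_assocDegreeFiltration_le hX' (adjoin_image_ι_eq_top hXgen)
  obtain ⟨c', hc'⟩ := exists_assocDegreeFiltration_le (hX.image (ι F)) hX'gen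
  obtain ⟨d, hd⟩ := exists_assocDegreeFiltration_le hY' (adjoin_image_ι_eq_top hYgen)
  obtain ⟨d', hd'⟩ := exists_assocDegreeFiltration_le (hY.image (ι F)) hY'gen
  have hex : ∀ n, ∃ m, assocDegreeFiltration F (ι F '' X) n
      ⊓ LinearMap.range (envelopingMap M).toLinearMap
        ≤ (assocDegreeFiltration F (ι F '' Y) m).map (envelopingMap M).toLinearMap :=
    fun n => ⟨_, assocDegreeFiltration_inf_range_le hX hXgen hYgen n⟩
  -- Finiteness of the distortion for X' and Y' is inherited from ι(X) and ι(Y) by rescaling.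
  have hex' : ∀ n, ∃ m, assocDegreeFiltration F X' n
      ⊓ LinearMap.range (envelopingMap M).toLinearMap
        ≤ (assocDegreeFiltration F Y' m).map (envelopingMap M).toLinearMap := fun n =>
    let ⟨_, hm⟩ := hex (c * n)
    ⟨_, (inf_le_inf_right _ (hc n)).trans (hm.trans (Submodule.map_mono (hd' _)))⟩
  have heq : assocDistortion (envelopingMap M) X' Y' = (lieDistortion M X Y).closure := by
    change _ = GrowthClass.mk (superadditiveClosure (lieDistortionFun X Y))
    rw [← envelopingDistortionFun_eq hX hXgen hYgen]
    exact Quotient.sound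
      ⟨distortion_majorated hc hd' (assocDegreeFiltration_mono _) hex,
        distortion_majorated hc' hd (assocDegreeFiltration_mono _) hex'⟩
  refine ⟨envelopingMap_injective M, heq, ?_, ?_⟩
  · rw [heq]
    exact Majorated.of_le (le_superadditiveClosure lieDistortionFun_zero)
  · rw [GrowthClass.IsSuperadditive, heq]
    change GrowthClass.mk _ = GrowthClass.mk (superadditiveClosure (superadditiveClosure _))
    rw [superadditiveClosure_superadditiveClosure]
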